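/- **Setting.** Consider a single-item auction with $n$ bidders. Each bidder $i\in[n]$ has a binary signal $s_i\in\{0,1\}$; a signal profile is identified with the set $S=\{i: s_i=1\}\subseteq[n]$. Bidder $i$'s value for the item is $v_i(S)$, where $v_i:2^{[n]}\to\mathbb{R}_{\ge 0}$ is monotone ($S\subseteq T$ implies $v_i(S)\le v_i(T)$) and submodular ($v_i(T\cup\{a\})-v_i(T)\le v_i(S\cup\{a\})-v_i(S)$ for all $S\subseteq T$ and $a\notin T$). Let $\mathrm{OPT}(S)=\max_i v_i(S)$. A randomized mechanism is a pair $M=(x,p)$ which maps each reported profile $S$ to allocation probabilities $x_i(S)\ge 0$ with $\sum_i x_i(S)\le 1$ and to expected payments $p_i(S)\ge 0$. It is *ex post IC-IR* if for every bidder $i$ and true profile $S$, when the others report truthfully, the expected utility $x_i(S')v_i(S)-p_i(S')$ of bidder $i$ (where $S'$ is the profile in which $i$'s signal is replaced by her report) is maximized by reporting truthfully ($S'=S$), and is then non-negative. It achieves a *$2$-approximation* if $\sum_i x_i(S)v_i(S)\ge \frac12\mathrm{OPT}(S)$ for every profile $S$. **Algorithm.** Keep a table with a color for every cell $(i,S)$,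 $i\in[n]$, $S\subseteq[n]$, initially all white. Let $S_1,\dots,S_{2^n}$ be an ordering of all subsets of $[n]$ in which $S_k\subsetneq S_\ell$ implies $k<\ell$. * ColorBlack$(b,S)$: if $(b,S)$ is red, report an error; if it is black, return. Otherwise color it black and, if $b\in S$, call ColorBlack$(b,S\setminus\{b\})$. * ColorRed$(b,S)$: if $(b,S)$ is black, report an error; if it is red, return; if two other cells of column $S$ are red, report an error. Otherwise color $(b,S)$ red; then, if another cell $(b_1,S)$ is red, call ColorBlack$(b',S)$ for all $b'\ne b,b_1$; then, if $b\notin S$, call ColorRed$(b,S\cup\{b\})$. * Main loop, for $S=S_1,\dots,S_{2^n}$: if exactly two cells of column $S$ are red, go on to the next set. Otherwise, if there are $b_1\neq b_2$ in $S$ such that neither $(b_1,S)$ nor $(b_2,S)$ is black, no other cell of column $S$ is red, and $v_{b_1}(S)+v_{b_2}(S)\ge\mathrm{OPT}(S)$, choose any such pair and call ColorRed$(b_1,S)$ and ColorRed$(b_2,S)$. Otherwise, if there is a bidder $b$ such that $(b,S)$ is not black and $v_b(S)=\mathrm{OPT}(S)$, choose any such $b$, call ColorRed$(b,S)$, and then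 call ColorBlack$(b',S)$ for every $b'$ whose cell in column $S$ is white. The final table encodes the allocation rule $x_i(S)=\frac12$ if $(i,S)$ is red and $x_i(S)=0$ if it is black. **Theorem 1.** For every $n$ and all non-negative, monotone, submodular valuations $v_1,\dots,v_n$ as above: 1. there is an ex post IC-IR randomized mechanism which achieves a $2$-approximation to the optimal welfare and all of whose allocation probabilities $x_i(S)$ are $0$ or $\frac12$; 2. such a mechanism is constructed by the algorithm: for every ordering as above and however the choices are made, the algorithm terminates without an error, every cell is finally red or black, and there are payments $p$ which together with the encoded allocation rule $x$ form an ex post IC-IR mechanism that achieves a $2$-approximation. -/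

import Mathlib

namespace SOSAuction

/-! A signal profile of `n` bidders with binary signals is a `Finset (Fin n)`: the set of the
bidders whose signal is `1`. A setting is a family `v` of valuation functions, `v i S` being the
value of bidder `i` for the item at the signal profile `S`. -/

/-- Submodularity of a real-valued set function on the subsets of `Fin n`. -/
def Submodular {n : ℕ} (f : Finset (Fin n) → ℝ) : Prop :=
  ∀ S T : Finset (Fin n), S ⊆ T → ∀ a : Fin n, a ∉ T →
    f (insert a T) - f T ≤ f (insert a S) - f S

/-- The signal profile that arises from `S` when the signal of bidder `i` is replaced by `r`
(`true` stands for signal `1`) and all other signals are kept. -/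
def withReport {n : ℕ} (S : Finset (Fin n)) (i : Fin n) (r : Bool) : Finset (Fin n) :=
  if r then insert i S else S.erase i

/-- A randomized mechanism: `alloc i S` is the probability with which bidder `i` gets the item and
`payment i S` is the expected payment of bidder `i` when the reported signal profile is `S`. -/
structure Mechanism (n : ℕ) where
  alloc : Fin n → Finset (Fin n) → ℝ
  payment : Fin n → Finset (Fin n) → ℝ
  alloc_nonneg : ∀ i S, 0 ≤ alloc i S
  feasible : ∀ S, ∑ i, alloc i S ≤ 1
  payment_nonneg : ∀ i S, 0 ≤ payment i S

/-- Expected utility of bidder `i` at the true signal profile `S` when she reports the signal `r`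
and all others report their signals truthfully. -/
def Mechanism.utility {n : ℕ} (M : Mechanism n) (v : Fin n → Finset (Fin n) → ℝ)
    (i : Fin n) (S : Finset (Fin n)) (r : Bool) : ℝ :=
  M.alloc i (withReport S i r) * v i S - M.payment i (withReport S i r)

/-- Ex post incentive compatibility and individual rationality: truthful reporting gives a
non-negative utility and maximizes the utility. -/
def Mechanism.IsExPostICIR {n : ℕ} (M : Mechanism n) (v : Fin n → Finset (Fin n) → ℝ) : Prop :=
  ∀ (i : Fin n) (S : Finset (Fin n)),
    0 ≤ M.utility v i S (decide (i ∈ S)) ∧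
    ∀ r : Bool, M.utility v i S r ≤ M.utility v i S (decide (i ∈ S))

/-- The optimal welfare at the signal profile `S`: the highest value of a bidder. -/
noncomputable def OPT {n : ℕ} (v : Fin n → Finset (Fin n) → ℝ) (S : Finset (Fin n)) : ℝ :=
  ⨆ i, v i S

/-- The expected welfare of a mechanism at the true signal profile `S`. -/
def Mechanism.welfare {n : ℕ} (M : Mechanism n) (v : Fin n → Finset (Fin n) → ℝ)
    (S : Finset (Fin n)) : ℝ :=
  ∑ i, M.alloc i S * v i S

/-- The mechanism achieves a `c`-approximation to the optimal welfare, at every signal profile. -/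
def Mechanism.IsApprox {n : ℕ} (M : Mechanism n) (v : Fin n → Finset (Fin n) → ℝ)
    (c : ℝ) : Prop :=
  ∀ S : Finset (Fin n), 1 / c * OPT v S ≤ M.welfare v S

/-! The coloring algorithm. -/

inductive Color where
  | white
  | red
  | black
  deriving DecidableEq

/-- The allocation table: a color for every bidder and every signal profile. -/
abbrev Table (n : ℕ) := Fin n → Finset (Fin n) → Color

/-- The initial table, all white. -/
def Table.init (n : ℕ) : Table n := fun _ _ => Color.white

/-- The table `t` with the cell `(b, S)` recolored to `c`. -/
def Table.set {n : ℕ} (t : Table n) (b : Fin n) (S : Finset (Fin n)) (c : Color) : Table n :=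
  fun b' S' => if b' = b ∧ S' = S then c else t b' S'

/-- Color the cell `(b, S)` black and propagate backward; `none` is an error. -/
def colorBlack {n : ℕ} (t : Table n) (b : Fin n) (S : Finset (Fin n)) : Option (Table n) :=
  match t b S with
  | .red => none
  | .black => some t
  | .white =>
    if _h : b ∈ S then colorBlack (t.set b S .black) b (S.erase b)
    else some (t.set b S .black)
  termination_by S.card
  decreasing_by exact Finset.card_erase_lt_of_mem _h

/-- Color black, one after the other, the cells in column `S` of all bidders other than `b`
and `b₁`. -/
def blackenOthers {n : ℕ} (t : Table n) (b b₁ : Fin n) (S : Finset (Fin n)) :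
    Option (Table n) :=
  ((List.finRange n).filter (fun b' => b' ≠ b ∧ b' ≠ b₁)).foldlM
    (fun t b' => colorBlack t b' S) t

/-- If a bidder `b₁ ≠ b` is red in column `S`, then color all bidders other than `b`, `b₁` black
in this column. -/
def closeColumn {n : ℕ} (t : Table n) (b : Fin n) (S : Finset (Fin n)) : Option (Table n) :=
  match (List.finRange n).find? (fun b₁ => b₁ ≠ b ∧ t b₁ S = .red) with
  | some b₁ => blackenOthers t b b₁ S
  | none => some t

/-- Color the cell `(b, S)` red, color the other bidders black if there are now two reds in the
column, and propagate forward; `none` is an error. -/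
def colorRed {n : ℕ} (t : Table n) (b : Fin n) (S : Finset (Fin n)) : Option (Table n) :=
  match t b S with
  | .black => none
  | .red => some t
  | .white =>
    if ∃ b₁ b₂, b₁ ≠ b ∧ b₂ ≠ b ∧ b₁ ≠ b₂ ∧ t b₁ S = .red ∧ t b₂ S = .red then none
    else
      (closeColumn (t.set b S .red) b S).bind fun t' =>
        if _h : b ∉ S then colorRed t' b (insert b S) else some t'
  termination_by Sᶜ.card
  decreasing_by
    apply Finset.card_lt_card
    rw [Finset.compl_ssubset_compl]
    exact Finset.ssubset_insert _h

/-- Color black, one after the other, the cells in column `S` that are white. -/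
def blackenWhites {n : ℕ} (t : Table n) (S : Finset (Fin n)) : Option (Table n) :=
  (List.finRange n).foldlM (fun t b => if t b S = .white then colorBlack t b S else some t) t

/-- The number of red cells in column `S`. -/
def redCount {n : ℕ} (t : Table n) (S : Finset (Fin n)) : ℕ :=
  (Finset.univ.filter fun b => t b S = Color.red).card

/-- The pair `b₁`, `b₂` is favored with the first priority in column `S`. -/
def FavoredPair {n : ℕ} (v : Fin n → Finset (Fin n) → ℝ) (t : Table n) (S : Finset (Fin n))
    (b₁ b₂ : Fin n) : Prop :=
  b₁ ≠ b₂ ∧ b₁ ∈ S ∧ b₂ ∈ S ∧ t b₁ S ≠ .black ∧ t b₂ S ≠ .black ∧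
    (∀ b₃, b₃ ≠ b₁ → b₃ ≠ b₂ → t b₃ S ≠ .red) ∧ OPT v S ≤ v b₁ S + v b₂ S

/-- The bidder `b` is favored with the second priority in column `S`. -/
def FavoredBidder {n : ℕ} (v : Fin n → Finset (Fin n) → ℝ) (t : Table n) (S : Finset (Fin n))
    (b : Fin n) : Prop :=
  t b S ≠ .black ∧ v b S = OPT v S

/-- `Iteration v S t r`: the iteration of the main loop for the column `S`, started from the table
`t`, can end with the result `r` (`none` is an error). The choice among several favored pairs or
bidders is left open. -/
inductive Iteration {n : ℕ} (v : Fin n → Finset (Fin n) → ℝ) (S : Finset (Fin n))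
    (t : Table n) : Option (Table n) → Prop
  | skip (h : redCount t S = 2) : Iteration v S t (some t)
  | priority_one (b₁ b₂ : Fin n) (h : redCount t S ≠ 2) (hf : FavoredPair v t S b₁ b₂) :
      Iteration v S t ((colorRed t b₁ S).bind fun t' => colorRed t' b₂ S)
  | priority_two (b : Fin n) (h : redCount t S ≠ 2) (hn : ∀ b₁ b₂, ¬ FavoredPair v t S b₁ b₂)
      (hf : FavoredBidder v t S b) :
      Iteration v S t ((colorRed t b S).bind fun t' => blackenWhites t' S)
  | idle (h : redCount t S ≠ 2) (hn : ∀ b₁ b₂, ¬ FavoredPair v t S b₁ b₂)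
      (hn' : ∀ b, ¬ FavoredBidder v t S b) : Iteration v S t (some t)

/-- `Run v L t r`: the main loop over the list `L` of columns, started from the table `t`, can end
with the result `r` (`none` is an error, at which the run stops). -/
inductive Run {n : ℕ} (v : Fin n → Finset (Fin n) → ℝ) :
    List (Finset (Fin n)) → Table n → Option (Table n) → Prop
  | nil (t : Table n) : Run v [] t (some t)
  | error (S : Finset (Fin n)) (L : List (Finset (Fin n))) (t : Table n)
      (h : Iteration v S t none) : Run v (S :: L) t none
  | step (S : Finset (Fin n)) (L : List (Finset (Fin n))) (t t' : Table n)
      (r : Option (Table n)) (h : Iteration v S t (some t')) (hr : Run v L t' r) :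
      Run v (S :: L) t r

/-- The list `L` is an ordering of all subsets of `Fin n` in which an included set always comes
before the including one. -/
def IsInclusionCompatible {n : ℕ} (L : List (Finset (Fin n))) : Prop :=
  L.Nodup ∧ (∀ S, S ∈ L) ∧
    ∀ k l : Fin L.length, L.get k ⊂ L.get l → k < l

/-- The allocation rule that is encoded by a table: red is the probability `1 / 2` and black is
the probability `0` (a white cell counts as black). -/
noncomputable def Table.alloc {n : ℕ} (t : Table n) : Fin n → Finset (Fin n) → ℝ :=
  fun b S => if t b S = .red then 1 / 2 else 0

end SOSAuction

/-!
The algorithm colors a cell `(b, S)` with `b ∉ S` red only in its second priority, when `b` has the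
highest value at `S` and no pair of bidders with signal `1` is favored. That red is propagated to
`(b, insert b S)`, and the column `insert b S` is closed as soon as it has two red cells. So the
allocation is monotone in each bidder's own signal, which is what payments need
(`Table.mechanism_isExPostICIR`), and every column has at most two red cells, which is feasibility.

Welfare: if both red cells `(a, S)` and `(b, S)` of a column were propagated, then `a` and `b` have
the highest values at `S.erase a` and `S.erase b`, and submodularity gives
`OPT v S ≤ v a S + v b S` (`OPT_le_add`). In all other columns the choice made in that column
ensures this bound or a red bidder of the highest value.

The crux is that a column `S` without a favored pair always has a favored bidder. If the bidder `c`
of the highest value is black at `S`, then this color was propagated backward from the column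
`T = insert c S`, in which two other bidders `a` and `b` are red, by propagation from `T.erase a` and
`T.erase b`. The absence of a favored pair when these two columns and `S = T.erase c` are processed
turns into inequalities between values, collected in `Dominates`: at each of the three profiles the
bidder whose signal is removed beats all pairs, or all pairs that contain the bidder who was red
there already. By submodularity these inequalities are contradictory (`not_dominates_three`).

The rest is bookkeeping: `Invariant` records where red and black cells come from, and
`Invariant.paint`, `Invariant.colorRed_eq` and `Invariant.iteration` show that no operation raises
an error and that each of them keeps the invariant.
-/

namespace SOSAuction

variable {n : ℕ}

theorem le_OPT (v : Fin n → Finset (Fin n) → ℝ) (i : Fin n) (S : Finset (Fin n)) :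
    v i S ≤ OPT v S :=
  le_ciSup (f := fun i => v i S) (Set.finite_range _).bddAbove i

theorem Submodular.erase_add_erase {f : Finset (Fin n) → ℝ} (hf : Submodular f)
    {X : Finset (Fin n)} {y z : Fin n} (hy : y ∈ X) (hyz : y ≠ z) :
    f X + f ((X.erase y).erase z) ≤ f (X.erase y) + f (X.erase z) := by
  have h := hf ((X.erase y).erase z) (X.erase y) (Finset.erase_subset _ _) y
    (Finset.notMem_erase _ _)
  have e : insert y ((X.erase y).erase z) = X.erase z := by
    rw [Finset.erase_right_comm, Finset.insert_erase]
    exact Finset.mem_erase.2 ⟨hyz, hy⟩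
  rw [Finset.insert_erase hy, e] at h
  linarith

/-! ### Consequences of submodularity -/

/-- Bidder `a` (in the applications, `a ∉ X`) has the highest value at `X`, and no pair of bidders
in `X` is worth as much as `a` alone, where either all pairs are considered or only the pairs that
contain a bidder `d ∈ X` who has the highest value at `X.erase d`. The second alternative describes
a column in which `d` was red already when it was processed. -/
def Dominates (v : Fin n → Finset (Fin n) → ℝ) (X : Finset (Fin n)) (a : Fin n) : Prop :=
  v a X = OPT v X ∧
    ((∀ x ∈ X, ∀ y ∈ X, x ≠ y → v x X + v y X < v a X) ∨
      ∃ d ∈ X, v d (X.erase d) = OPT v (X.erase d) ∧ ∀ x ∈ X, x ≠ d → v d X + v x X < v a X)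

/-- In the second alternative, submodularity of `v a` along `d` and `y`, together with
`v a (X.erase d) ≤ v d (X.erase d)`, shows that `a` beats `x` even without the signal of `y`. -/
theorem Dominates.pair_lt_or {v : Fin n → Finset (Fin n) → ℝ} (hnonneg : ∀ i S, 0 ≤ v i S)
    (hmono : ∀ i, Monotone (v i)) (hsub : ∀ i, Submodular (v i))
    {X : Finset (Fin n)} {a b c : Fin n} (h : Dominates v X a) (hb : b ∈ X) (hc : c ∈ X)
    (hbc : b ≠ c) :
    v b X + v c X < v a X ∨
      (v b X < v a (X.erase b) ∧ v c X < v a (X.erase b) ∧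
        v b X < v a (X.erase c) ∧ v c X < v a (X.erase c)) := by
  obtain ⟨-, h | ⟨d, hd, hdo, h⟩⟩ := h
  · exact Or.inl (h b hb c hc hbc)
  by_cases hdb : d = b
  · subst hdb; exact Or.inl (h c hc hbc.symm)
  by_cases hdc : d = c
  · subst hdc; have := h b hb hbc; left; linarith
  right
  have key : ∀ x ∈ X, x ≠ d → ∀ y, y ≠ d → v x X < v a (X.erase y) := by
    intro x hx hxd y hyd
    have h1 := h x hx hxd
    have h2 := (hsub a).erase_add_erase hd (Ne.symm hyd)
    have h3 := le_OPT v a (X.erase d)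
    have h4 := hmono d (Finset.erase_subset d X)
    have h5 := hnonneg a ((X.erase d).erase y)
    linarith
  exact ⟨key b hb (Ne.symm hdb) b (Ne.symm hdb), key c hc (Ne.symm hdc) b (Ne.symm hdb),
    key b hb (Ne.symm hdb) c (Ne.symm hdc), key c hc (Ne.symm hdc) c (Ne.symm hdc)⟩

/-- Among three signals `a`, `b`, `c` of `T`, it is impossible that each of the three bidders
dominates the profile in which exactly her own signal is removed. -/
theorem not_dominates_three {v : Fin n → Finset (Fin n) → ℝ} (hnonneg : ∀ i S, 0 ≤ v i S)
    (hmono : ∀ i, Monotone (v i)) (hsub : ∀ i, Submodular (v i))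
    {T : Finset (Fin n)} {a b c : Fin n} (ha : a ∈ T) (hb : b ∈ T) (hc : c ∈ T)
    (hab : a ≠ b) (hac : a ≠ c) (hbc : b ≠ c)
    (hA : Dominates v (T.erase a) a) (hB : Dominates v (T.erase b) b)
    (hC : Dominates v (T.erase c) c) : False := by
  have mem : ∀ {x y : Fin n}, x ∈ T → x ≠ y → x ∈ T.erase y := fun hx hxy =>
    Finset.mem_erase.2 ⟨hxy, hx⟩
  have hA' := hA.pair_lt_or hnonneg hmono hsub (mem hb hab.symm) (mem hc hac.symm) hbc
  have hB' := hB.pair_lt_or hnonneg hmono hsub (mem ha hab) (mem hc hbc.symm) hac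
  have hC' := hC.pair_lt_or hnonneg hmono hsub (mem ha hac) (mem hb hbc) hab
  have sA := (hsub a).erase_add_erase (mem hb hab.symm) hbc
  have sB := (hsub b).erase_add_erase (mem ha hab) hac
  have sC := (hsub c).erase_add_erase (mem ha hac) hab
  have p := hnonneg a (((T.erase a).erase b).erase c)
  have q := hnonneg b (((T.erase b).erase a).erase c)
  have r := hnonneg c (((T.erase c).erase a).erase b)
  have e1 : (T.erase b).erase a = (T.erase a).erase b := Finset.erase_right_comm
  have e2 : (T.erase c).erase a = (T.erase a).erase c := Finset.erase_right_comm
  have e3 : (T.erase c).erase b = (T.erase b).erase c := Finset.erase_right_comm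
  simp only [e1, e2, e3] at hA' hB' hC' sA sB sC q r
  have m : ∀ i x y, v i ((T.erase x).erase y) ≤ v i (T.erase x) := fun i x y =>
    hmono i (Finset.erase_subset _ _)
  have m' : ∀ i x y, v i ((T.erase x).erase y) ≤ v i (T.erase y) := fun i x y =>
    Finset.erase_right_comm (s := T) (a := x) (b := y) ▸ m i y x
  rcases hA' with hA | ⟨hA1, hA2, hA3, hA4⟩ <;> rcases hB' with hB | ⟨hB1, hB2, hB3, hB4⟩ <;>
    rcases hC' with hC | ⟨hC1, hC2, hC3, hC4⟩ <;>
    linarith [m a a b, m b a b, m c a b, m' a a b, m' b a b, m' c a b,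
      m a a c, m b a c, m c a c, m' a a c, m' b a c, m' c a c,
      m a b c, m b b c, m c b c, m' a b c, m' b b c, m' c b c]

/-- If `a` and `b` have the highest values at the profiles without their own signals, then
together they are worth the optimum at the full profile. -/
theorem OPT_le_add {v : Fin n → Finset (Fin n) → ℝ} (hnonneg : ∀ i S, 0 ≤ v i S)
    (hmono : ∀ i, Monotone (v i)) (hsub : ∀ i, Submodular (v i))
    {S : Finset (Fin n)} {a b : Fin n} (ha : a ∈ S) (hab : a ≠ b)
    (hA : v a (S.erase a) = OPT v (S.erase a)) (hB : v b (S.erase b) = OPT v (S.erase b)) :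
    OPT v S ≤ v a S + v b S := by
  have : Nonempty (Fin n) := ⟨a⟩
  refine ciSup_le fun i => ?_
  have h1 := (hsub i).erase_add_erase ha hab
  have h2 := hnonneg i ((S.erase a).erase b)
  have h3 := le_OPT v i (S.erase a)
  have h4 := le_OPT v i (S.erase b)
  have h5 := hmono a (Finset.erase_subset a S)
  have h6 := hmono b (Finset.erase_subset b S)
  linarith

/-! ### Exact effect of the blackening operations -/

/-- The table in which the cells `(b, S)` and `(b, S.erase b)` of all `b ∈ A` are black. -/
def Table.blacken (t : Table n) (A : List (Fin n)) (S : Finset (Fin n)) : Table n :=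
  fun b X => if b ∈ A ∧ (X = S ∨ X = S.erase b) then .black else t b X

theorem colorBlack_eq (t : Table n) (b : Fin n) (S : Finset (Fin n))
    (h : t b S ≠ .red) (h' : t b (S.erase b) ≠ .red)
    (hb : t b S = .black → t b (S.erase b) = .black) :
    colorBlack t b S = some (t.blacken [b] S) := by
  rw [colorBlack]
  split
  · contradiction
  · rename_i hS
    congr 1
    funext a X
    simp only [Table.blacken, List.mem_singleton]
    split_ifs with hX
    · obtain ⟨rfl, rfl | rfl⟩ := hX
      · exact hS
      · exact hb hS
    · rfl
  · rename_i hS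
    split_ifs with hm
    · have hne : S.erase b ≠ S := fun e => by
        rw [← e] at hm; exact Finset.notMem_erase _ _ hm
      rw [colorBlack]
      have hc : (t.set b S .black) b (S.erase b) = t b (S.erase b) := by
        simp [Table.set, hne]
      rw [hc]
      split
      · contradiction
      · rename_i hS'
        congr 1
        funext a X
        simp only [Table.blacken, Table.set, List.mem_singleton]
        by_cases ha : a = b <;> by_cases hX : X = S <;> by_cases hX' : X = S.erase b <;>
          simp_all
      · rw [dif_neg (Finset.notMem_erase _ _)]
        congr 1
        funext a X
        simp only [Table.blacken, Table.set, List.mem_singleton]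
        by_cases ha : a = b <;> by_cases hX : X = S <;> by_cases hX' : X = S.erase b <;>
          simp_all
    · congr 1
      funext a X
      simp only [Table.blacken, Table.set, List.mem_singleton]
      by_cases ha : a = b <;> by_cases hX : X = S <;> simp_all

theorem foldlM_colorBlack_eq (S : Finset (Fin n)) (A : List (Fin n)) :
    ∀ t : Table n, (∀ b ∈ A, t b S ≠ .red ∧ t b (S.erase b) ≠ .red ∧
      (t b S = .black → t b (S.erase b) = .black)) →
    A.foldlM (fun t b => colorBlack t b S) t = some (t.blacken A S) := by
  induction A with
  | nil =>
    intro t _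
    have e : t.blacken [] S = t := by funext b X; simp [Table.blacken]
    rw [e]; rfl
  | cons a A ih =>
    intro t h
    obtain ⟨h1, h2, h3⟩ := h a (by simp)
    rw [List.foldlM_cons, colorBlack_eq t a S h1 h2 h3, Option.bind_eq_bind, Option.bind_some,
      ih]
    · congr 1
      funext b X
      simp only [Table.blacken, List.mem_cons]
      by_cases hb : b = a <;> by_cases hbA : b ∈ A <;> simp_all
    · intro b hb
      obtain ⟨h1, h2, h3⟩ := h b (by simp [hb])
      simp only [Table.blacken, List.mem_singleton]
      by_cases hba : b = a <;> simp_all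

theorem foldlM_blackenWhite_eq (S : Finset (Fin n)) (A : List (Fin n)) :
    ∀ t : Table n, (∀ b ∈ A, b ∈ S → t b S = .white → t b (S.erase b) = .black) →
    A.foldlM (fun t b => if t b S = .white then colorBlack t b S else some t) t =
      some (fun b X => if b ∈ A ∧ X = S ∧ t b X = .white then .black else t b X) := by
  induction A with
  | nil =>
    intro t _
    simp
  | cons a A ih =>
    intro t h
    have step : (if t a S = .white then colorBlack t a S else some t) =
        some (fun b X => if b = a ∧ X = S ∧ t b X = .white then .black else t b X) := by
      by_cases hw : t a S = .white
      · by_cases ha : a ∈ S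
        · have h' := h a (by simp) ha hw
          rw [if_pos hw, colorBlack_eq t a S (by simp [hw]) (by simp [h']) (fun _ => h')]
          congr 1
          funext b X
          simp only [Table.blacken, List.mem_singleton]
          by_cases hb : b = a <;> by_cases hX : X = S <;> by_cases hX' : X = S.erase a <;>
            simp_all
        · have e : S.erase a = S := Finset.erase_eq_of_notMem ha
          rw [if_pos hw, colorBlack_eq t a S (by simp [hw]) (by simp [hw, e]) (by simp [hw])]
          congr 1
          funext b X
          simp only [Table.blacken, List.mem_singleton]
          by_cases hb : b = a <;> by_cases hX : X = S <;> simp_all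
      · rw [if_neg hw]
        congr 1
        funext b X
        split_ifs with hb
        · obtain ⟨rfl, rfl, hb⟩ := hb; contradiction
        · rfl
    rw [List.foldlM_cons, step, Option.bind_eq_bind, Option.bind_some, ih]
    · congr 1
      funext b X
      simp only [List.mem_cons]
      by_cases hb : b = a <;> by_cases hbA : b ∈ A <;> by_cases hX : X = S <;>
        by_cases hw : t b X = .white <;> simp_all
    · intro b hb hbS
      have := h b (by simp [hb]) hbS
      have hne : S.erase b ≠ S := fun e => by
        rw [← e] at hbS; exact Finset.notMem_erase _ _ hbS
      by_cases hba : b = a <;> by_cases hw : t b S = .white <;> simp_all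

/-! ### The invariant of the main loop -/

/-- The red cells of the column `S` are worth at least the optimum, so that allocating with
probability `1 / 2` to each of them is a `2`-approximation. -/
def Table.Covers (t : Table n) (v : Fin n → Finset (Fin n) → ℝ) (S : Finset (Fin n)) : Prop :=
  OPT v S ≤ ∑ b, if t b S = .red then v b S else 0

/-- The invariant of the algorithm. The main loop has started on the columns in `P` and has
finished with the columns in `F`; `pending` holds the red cells `(b, S)` from which the color is
still to be propagated to `(b, insert b S)`. -/
structure Invariant (v : Fin n → Finset (Fin n) → ℝ) (P F : Set (Finset (Fin n)))
    (pending : Fin n → Finset (Fin n) → Prop) (t : Table n) : Prop where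
  red_insert : ∀ b S, b ∉ S → t b S = .red → t b (insert b S) = .red ∨ pending b S
  black_erase : ∀ b S, b ∈ S → t b S = .black → t b (S.erase b) = .black
  closed : ∀ S a b c, a ≠ b → c ≠ a → c ≠ b → t a S = .red → t b S = .red → t c S = .black
  dominates : ∀ b S, b ∉ S → t b S = .red → Dominates v S b
  /-- Before a column is processed, its red cells come from forward propagation. -/
  red_origin : ∀ b, ∀ S ∉ P, t b S = .red → b ∈ S ∧ t b (S.erase b) = .red
  /-- Before a column is processed, its black cells come from two red cells in this column or from
  backward propagation. -/
  black_origin : ∀ b, ∀ S ∉ P, t b S = .black →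
    (∃ a₁ a₂, a₁ ≠ a₂ ∧ t a₁ S = .red ∧ t a₂ S = .red) ∨ (b ∉ S ∧ t b (insert b S) = .black)
  no_white : ∀ b, ∀ S ∈ F, t b S ≠ .white
  covers : ∀ S ∈ F, t.Covers v S

/-- The predicate `pending` of `Invariant` when all colors are propagated. -/
def noPending : Fin n → Finset (Fin n) → Prop := fun _ _ => False

theorem Table.Covers.mono {v : Fin n → Finset (Fin n) → ℝ} (hnonneg : ∀ i S, 0 ≤ v i S)
    {t t' : Table n} {S : Finset (Fin n)} (h : t.Covers v S)
    (htt : ∀ b, t b S = .red → t' b S = .red) : t'.Covers v S := by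
  refine h.trans (Finset.sum_le_sum fun b _ => ?_)
  by_cases hb : t b S = .red
  · simp [hb, htt b hb]
  · rw [if_neg hb]
    split_ifs
    exacts [hnonneg b S, le_rfl]

theorem Table.covers_of_red {v : Fin n → Finset (Fin n) → ℝ} (hnonneg : ∀ i S, 0 ≤ v i S)
    {t : Table n} {S : Finset (Fin n)} {b : Fin n} (hb : t b S = .red) (h : v b S = OPT v S) :
    t.Covers v S := by
  rw [Table.Covers, ← h]
  have := Finset.single_le_sum (f := fun b => if t b S = .red then v b S else 0)
    (fun i _ => by split_ifs; exacts [hnonneg i S, le_rfl]) (Finset.mem_univ b)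
  simpa [hb] using this

theorem Table.covers_of_pair {v : Fin n → Finset (Fin n) → ℝ} (hnonneg : ∀ i S, 0 ≤ v i S)
    {t : Table n} {S : Finset (Fin n)} {a b : Fin n} (hab : a ≠ b) (ha : t a S = .red)
    (hb : t b S = .red) (h : OPT v S ≤ v a S + v b S) : t.Covers v S := by
  refine h.trans ?_
  have := Finset.sum_le_sum_of_subset_of_nonneg (Finset.subset_univ {a, b})
    (f := fun b => if t b S = .red then v b S else 0)
    (fun i _ _ => by split_ifs; exacts [hnonneg i S, le_rfl])
  rw [Finset.sum_pair hab] at this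
  simpa [ha, hb] using this

namespace Invariant

variable {v : Fin n → Finset (Fin n) → ℝ} {P F : Set (Finset (Fin n))}
  {pending : Fin n → Finset (Fin n) → Prop} {t : Table n}

theorem redCount_eq_two (h : Invariant v P F pending t) {S : Finset (Fin n)} {a b : Fin n}
    (hab : a ≠ b) (ha : t a S = .red) (hb : t b S = .red) : redCount t S = 2 := by
  rw [redCount, Finset.card_eq_two]
  refine ⟨a, b, hab, ?_⟩
  ext c
  simp only [Finset.mem_filter, Finset.mem_univ, true_and, Finset.mem_insert,
    Finset.mem_singleton]
  constructor
  · intro hc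
    by_contra! hcc
    simp [h.closed S a b c hab hcc.1 hcc.2 ha hb] at hc
  · rintro (rfl | rfl) <;> assumption

/-- Coloring a white cell red and closing its column succeeds, and keeps the invariant. The
hypothesis `hX` says that in a column that is not processed yet this is a forward propagation, and
`hpend'` that the new red cell becomes pending while a pending cell that it serves is resolved.
A cell of the column turns black only if there is another red cell besides it. -/
theorem paint (hnonneg : ∀ i S, 0 ≤ v i S) (h : Invariant v P F pending t)
    {pending' : Fin n → Finset (Fin n) → Prop} {b : Fin n} {X : Finset (Fin n)}
    (hw : t b X = .white) (hdom : b ∉ X → Dominates v X b)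
    (hX : X ∉ P → b ∈ X ∧ t b (X.erase b) = .red)
    (hpend : ∀ a Y, pending a Y → a = b)
    (hpend' : ∀ Y, b ∉ Y → pending b Y ∨ Y = X → insert b Y = X ∨ pending' b Y) :
    ∃ t', closeColumn (t.set b X .red) b X = some t' ∧ Invariant v P F pending' t' ∧
      t' b X = .red ∧ (∀ a Y, t a Y ≠ .white → t' a Y = t a Y) ∧
      ∀ a, t a X ≠ .black → t' a X = .black → ∃ d, d ≠ b ∧ d ≠ a ∧ t d X = .red := by
  -- The result of the coloring, given the list `A` of the bidders that are turned black.
  have main : ∀ A : List (Fin n), (∀ a ∈ A, a ≠ b) → (∀ a ∈ A, t a X ≠ .red) →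
      (∀ a ∈ A, t a (X.erase a) ≠ .red) →
      ((∃ b₁, b₁ ≠ b ∧ t b₁ X = .red ∧ ∀ a, a ∈ A ↔ a ≠ b ∧ a ≠ b₁) ∨
        (A = [] ∧ ∀ a, a ≠ b → t a X ≠ .red)) →
      let t' := (t.set b X .red).blacken A X
      Invariant v P F pending' t' ∧ t' b X = .red ∧
        (∀ a Y, t a Y ≠ .white → t' a Y = t a Y) ∧
        ∀ a, t a X ≠ .black → t' a X = .black → ∃ d, d ≠ b ∧ d ≠ a ∧ t d X = .red := by
    intro A hAb hAr hAe hA t'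
    have hred : t' b X = .red := by
      simp only [t', Table.blacken, Table.set]
      rw [if_neg fun hh => hAb b hh.1 rfl]
      simp
    have hblack : ∀ a ∈ A, t' a X = .black ∧ t' a (X.erase a) = .black := by
      intro a ha
      simp [t', Table.blacken, ha]
    have hkeep : ∀ a Y, t a Y ≠ .white → t' a Y = t a Y := by
      intro a Y hY
      simp only [t', Table.blacken, Table.set]
      split_ifs with h1 h2
      · obtain ⟨haA, rfl | rfl⟩ := h1
        · have := hAr a haA
          cases hc : t a Y <;> simp_all
        · have := hAe a haA
          cases hc : t a (X.erase a) <;> simp_all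
      · obtain ⟨rfl, rfl⟩ := h2; contradiction
      · rfl
    have hredof : ∀ a Y, t' a Y = .red → t a Y = .red ∨ (a = b ∧ Y = X) := by
      intro a Y
      simp only [t', Table.blacken, Table.set]
      split_ifs with h1 h2
      · simp
      · exact fun _ => Or.inr h2
      · exact Or.inl
    have hblackof : ∀ a Y, t' a Y = .black →
        t a Y = .black ∨ (a ∈ A ∧ (Y = X ∨ Y = X.erase a)) := by
      intro a Y
      simp only [t', Table.blacken, Table.set]
      split_ifs with h1 h2
      · exact fun _ => Or.inr h1
      · simp
      · exact Or.inl
    have kr : ∀ {a Y}, t a Y = .red → t' a Y = .red := fun hh => by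
      rw [hkeep _ _ (by simp [hh]), hh]
    have kb : ∀ {a Y}, t a Y = .black → t' a Y = .black := fun hh => by
      rw [hkeep _ _ (by simp [hh]), hh]
    have hclosed : ∀ a c, a ≠ b → c ≠ b → c ≠ a → t' a X = .red → t' c X = .black := by
      intro a c hab hcb hca har
      have har' : t a X = .red := (hredof a X har).resolve_right fun hh => hab hh.1
      obtain ⟨b₁, hb₁, hb₁r, hA⟩ | ⟨-, hA⟩ := hA
      · have : a = b₁ := by
          by_contra hne
          exact hAr a ((hA a).2 ⟨hab, hne⟩) har'
        subst this
        exact (hblack c ((hA c).2 ⟨hcb, hca⟩)).1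
      · exact absurd har' (hA a hab)
    refine ⟨⟨?_, ?_, ?_, ?_, ?_, ?_, ?_, ?_⟩, hred, hkeep, fun a hna ha => ?_⟩
    · intro a Y haY hr
      by_cases hab : a = b
      · subst hab
        have hcase : t a (insert a Y) = .red ∨ (pending a Y ∨ Y = X) := by
          rcases hredof a Y hr with hr | ⟨-, rfl⟩
          · exact (h.red_insert a Y haY hr).imp_right Or.inl
          · exact Or.inr (Or.inr rfl)
        rcases hcase with hr | hr
        · exact Or.inl (kr hr)
        · rcases hpend' Y haY hr with e | hp
          · left; rw [e]; exact hred
          · exact Or.inr hp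
      · have hr := (hredof a Y hr).resolve_right fun hh => hab hh.1
        exact Or.inl (kr ((h.red_insert a Y haY hr).resolve_right fun hp => hab (hpend a Y hp)))
    · intro a Y haY hbl
      rcases hblackof a Y hbl with hbl | ⟨haA, rfl | rfl⟩
      · exact kb (h.black_erase a Y haY hbl)
      · exact (hblack a haA).2
      · exact absurd haY (Finset.notMem_erase _ _)
    · intro Y a a' c haa hca hca' hra hra'
      by_cases hY : Y = X
      · subst hY
        by_cases hab : a = b
        · subst hab; exact hclosed a' c haa.symm hca hca' hra'
        by_cases hab' : a' = b
        · subst hab'; exact hclosed a c haa hca' hca hra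
        have h1 := (hredof a Y hra).resolve_right fun hh => hab hh.1
        have h2 := (hredof a' Y hra').resolve_right fun hh => hab' hh.1
        exact kb (h.closed Y a a' c haa hca hca' h1 h2)
      · have h1 := (hredof a Y hra).resolve_right fun hh => hY hh.2
        have h2 := (hredof a' Y hra').resolve_right fun hh => hY hh.2
        exact kb (h.closed Y a a' c haa hca hca' h1 h2)
    · intro a Y haY hr
      rcases hredof a Y hr with hr | ⟨rfl, rfl⟩
      · exact h.dominates a Y haY hr
      · exact hdom haY
    · intro a Y hY hr
      rcases hredof a Y hr with hr | ⟨rfl, rfl⟩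
      · exact (h.red_origin a Y hY hr).imp_right kr
      · exact (hX hY).imp_right kr
    · intro a Y hY hbl
      rcases hblackof a Y hbl with hbl | ⟨haA, hYX⟩
      · rcases h.black_origin a Y hY hbl with ⟨a₁, a₂, h12, h1, h2⟩ | ⟨h1, h2⟩
        · exact Or.inl ⟨a₁, a₂, h12, kr h1, kr h2⟩
        · exact Or.inr ⟨h1, kb h2⟩
      · have hpair : ∃ a₁ a₂, a₁ ≠ a₂ ∧ t' a₁ X = .red ∧ t' a₂ X = .red := by
          obtain ⟨b₁, hb₁, hb₁r, -⟩ | ⟨rfl, -⟩ := hA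
          · exact ⟨b₁, b, hb₁, kr hb₁r, hred⟩
          · simp at haA
        rcases hYX with rfl | rfl
        · exact Or.inl hpair
        · by_cases haX : a ∈ X
          · refine Or.inr ⟨Finset.notMem_erase _ _, ?_⟩
            rw [Finset.insert_erase haX]
            exact (hblack a haA).1
          · rw [Finset.erase_eq_of_notMem haX]
            exact Or.inl hpair
    · intro a Y hY
      rw [hkeep a Y (h.no_white a Y hY)]
      exact h.no_white a Y hY
    · intro Y hY
      exact (h.covers Y hY).mono hnonneg fun a ha => kr ha
    · have haA := ((hblackof a X ha).resolve_left hna).1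
      obtain ⟨b₁, hb₁, hb₁r, hA⟩ | ⟨rfl, -⟩ := hA
      · exact ⟨b₁, hb₁, ((hA a).1 haA).2.symm, hb₁r⟩
      · simp at haA
  rw [closeColumn]
  split
  · rename_i b₁ hfind
    have hb₁ := List.find?_some hfind
    simp only [decide_eq_true_eq] at hb₁
    obtain ⟨hb₁b, hb₁r⟩ := hb₁
    have hb₁r : t b₁ X = .red := by simpa [Table.set, hb₁b] using hb₁r
    have hne : ∀ a, a ≠ b → a ≠ b₁ → t a X ≠ .red := by
      intro a hab hab₁ har
      -- Two red cells would have made the cell of `b` black.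
      have := h.closed X a b₁ b hab₁ hab.symm hb₁b.symm har hb₁r
      simp [hw] at this
    have hne' : ∀ a, a ≠ b → a ≠ b₁ → t a (X.erase a) ≠ .red := by
      intro a hab hab₁ har
      by_cases haX : a ∈ X
      · have := (h.red_insert a _ (Finset.notMem_erase a X) har).resolve_right
          fun hp => hab (hpend a _ hp)
        rw [Finset.insert_erase haX] at this
        exact hne a hab hab₁ this
      · rw [Finset.erase_eq_of_notMem haX] at har
        exact hne a hab hab₁ har
    set A := (List.finRange n).filter (fun b' => b' ≠ b ∧ b' ≠ b₁) with hAdef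
    have hA : ∀ a, a ∈ A ↔ a ≠ b ∧ a ≠ b₁ := by
      intro a; simp [hAdef]
    refine ⟨(t.set b X .red).blacken A X, ?_, main A (fun a ha => ((hA a).1 ha).1)
      (fun a ha => hne a ((hA a).1 ha).1 ((hA a).1 ha).2)
      (fun a ha => hne' a ((hA a).1 ha).1 ((hA a).1 ha).2) (Or.inl ⟨b₁, hb₁b, hb₁r, hA⟩)⟩
    rw [blackenOthers]
    apply foldlM_colorBlack_eq
    intro a ha
    obtain ⟨hab, hab₁⟩ := (hA a).1 ha
    simp only [Table.set, hab, false_and, if_false]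
    refine ⟨hne a hab hab₁, hne' a hab hab₁, fun hbl => ?_⟩
    by_cases haX : a ∈ X
    · exact h.black_erase a X haX hbl
    · rwa [Finset.erase_eq_of_notMem haX]
  · rename_i hfind
    have hno : ∀ a, a ≠ b → t a X ≠ .red := by
      intro a hab har
      have := List.find?_eq_none.1 hfind a (List.mem_finRange a)
      simp [hab, Table.set, har] at this
    have e : (t.set b X .red).blacken [] X = t.set b X .red := by
      funext a Y; simp [Table.blacken]
    refine ⟨_, rfl, ?_⟩
    have := main [] (by simp) (by simp) (by simp) (Or.inr ⟨rfl, hno⟩)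
    rwa [e] at this

/-- A white cell has no two red cells in its column, so `colorRed` raises no error there. -/
theorem not_two_red (h : Invariant v P F pending t) {b : Fin n} {X : Finset (Fin n)}
    (hw : t b X = .white) :
    ¬ ∃ b₁ b₂, b₁ ≠ b ∧ b₂ ≠ b ∧ b₁ ≠ b₂ ∧ t b₁ X = .red ∧ t b₂ X = .red := by
  rintro ⟨b₁, b₂, h1, h2, h12, hr1, hr2⟩
  have := h.closed X b₁ b₂ b h12 h1.symm h2.symm hr1 hr2
  simp [hw] at this

/-- A call of `colorRed` in the column that is being processed succeeds and keeps the invariant. -/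
theorem colorRed_eq (hnonneg : ∀ i S, 0 ≤ v i S) (h : Invariant v P F noPending t)
    {b : Fin n} {S : Finset (Fin n)} (hS : S ∈ P) (hb : t b S ≠ .black)
    (hdom : b ∉ S → Dominates v S b) (hins : b ∉ S → insert b S ∉ P) :
    ∃ t', colorRed t b S = some t' ∧ Invariant v P F noPending t' ∧
      t' b S = .red ∧ (∀ a Y, t a Y ≠ .white → t' a Y = t a Y) ∧
      (b ∈ S → ∀ a, t a S ≠ .black → t' a S = .black → ∃ d, d ≠ b ∧ d ≠ a ∧ t d S = .red) := by
  rw [colorRed]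
  split
  · contradiction
  · rename_i hr
    exact ⟨t, rfl, h, hr, fun _ _ _ => rfl, fun _ _ h1 h2 => absurd h2 h1⟩
  · rename_i hw
    rw [if_neg (h.not_two_red hw)]
    by_cases hbS : b ∈ S
    · obtain ⟨t', h1, h2, h3, h4, h5⟩ := h.paint (pending' := noPending) hnonneg hw hdom
        (fun hh => absurd hS hh) (fun _ _ hh => hh.elim) (by
          rintro Y hbY (hh | rfl)
          · exact hh.elim
          · contradiction)
      refine ⟨t', ?_, h2, h3, h4, fun _ => h5⟩
      rw [h1, Option.bind_some, dif_neg (not_not.2 hbS)]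
    · obtain ⟨t₁, h1, h2, h3, h4, -⟩ := h.paint (pending' := fun a Y => a = b ∧ Y = S) hnonneg hw
        hdom (fun hh => absurd hS hh) (fun _ _ hh => hh.elim) (by
          rintro Y hbY (hh | rfl)
          · exact hh.elim
          · exact Or.inr ⟨rfl, rfl⟩)
      rw [h1, Option.bind_some, dif_pos hbS]
      have hbT : b ∈ insert b S := Finset.mem_insert_self b S
      rw [colorRed]
      split
      · rename_i hbl
        have := h2.black_erase b _ hbT hbl
        rw [Finset.erase_insert hbS, h3] at this
        simp at this
      · rename_i hr
        refine ⟨t₁, rfl, ⟨fun a Y haY har => ?_, h2.black_erase, h2.closed, h2.dominates,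
          h2.red_origin, h2.black_origin, h2.no_white, h2.covers⟩, h3, h4,
          fun hh => absurd hh hbS⟩
        rcases h2.red_insert a Y haY har with hh | ⟨rfl, rfl⟩
        · exact Or.inl hh
        · exact Or.inl hr
      · rename_i hwT
        rw [if_neg (h2.not_two_red hwT)]
        obtain ⟨t₂, k1, k2, k3, k4, -⟩ := h2.paint (pending' := noPending) hnonneg hwT
          (fun hh => absurd hbT hh)
          (fun _ => ⟨hbT, by rwa [Finset.erase_insert hbS]⟩) (fun _ _ hh => hh.1) (by
            rintro Y hbY (⟨-, rfl⟩ | rfl)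
            · exact Or.inl rfl
            · contradiction)
        refine ⟨t₂, ?_, k2, ?_, fun a Y hw => ?_, fun hh => absurd hh hbS⟩
        · rw [k1, Option.bind_some, dif_neg (not_not.2 hbT)]
        · rw [k4 b S (by simp [h3]), h3]
        · have e := h4 a Y hw
          rw [k4 a Y (by rwa [e]), e]

theorem start (h : Invariant v F F noPending t) (S : Finset (Fin n)) :
    Invariant v (insert S F) F noPending t :=
  ⟨h.red_insert, h.black_erase, h.closed, h.dominates,
    fun b X hX => h.red_origin b X fun hh => hX (Or.inr hh),
    fun b X hX => h.black_origin b X fun hh => hX (Or.inr hh), h.no_white, h.covers⟩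

theorem finish {S : Finset (Fin n)} (h : Invariant v (insert S F) F noPending t)
    (hw : ∀ b, t b S ≠ .white) (hc : t.Covers v S) :
    Invariant v (insert S F) (insert S F) noPending t := by
  refine ⟨h.red_insert, h.black_erase, h.closed, h.dominates, h.red_origin, h.black_origin, ?_, ?_⟩
  · rintro b X (rfl | hX)
    exacts [hw b, h.no_white b X hX]
  · rintro X (rfl | hX)
    exacts [hc, h.covers X hX]

theorem not_white_of_pair (h : Invariant v P F pending t) {S : Finset (Fin n)} {a b : Fin n}
    (hab : a ≠ b) (ha : t a S = .red) (hb : t b S = .red) (c : Fin n) : t c S ≠ .white := by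
  by_cases hca : c = a
  · simp [hca, ha]
  by_cases hcb : c = b
  · simp [hcb, hb]
  simp [h.closed S a b c hab hca hcb ha hb]

/-- If a column has no favored pair when it is processed, then a bidder of the highest value
dominates it: its only black cells are those of bidders outside `S`, and if there is a red cell,
then its color was propagated from the profile without the signal of its bidder. -/
theorem dominates_of_no_pair (h : Invariant v F F noPending t) {S : Finset (Fin n)}
    (hS : S ∉ F) (h2 : redCount t S ≠ 2) (hn : ∀ b₁ b₂, ¬ FavoredPair v t S b₁ b₂)
    {c : Fin n} (hc : v c S = OPT v S) : Dominates v S c := by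
  have hblack : ∀ x ∈ S, t x S ≠ .black := by
    intro x hx hbl
    rcases h.black_origin x S hS hbl with ⟨a₁, a₂, h12, h1, h2'⟩ | ⟨h1, -⟩
    · exact h2 (h.redCount_eq_two h12 h1 h2')
    · exact h1 hx
  refine ⟨hc, ?_⟩
  by_cases hr : ∃ d, t d S = .red
  · obtain ⟨d, hd⟩ := hr
    obtain ⟨hdS, hde⟩ := h.red_origin d S hS hd
    refine Or.inr ⟨d, hdS, (h.dominates d _ (Finset.notMem_erase _ _) hde).1, ?_⟩
    intro x hx hxd
    rw [hc]
    by_contra! hle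
    refine hn d x ⟨hxd.symm, hdS, hx, hblack d hdS, hblack x hx, fun b₃ h3 _ hr3 => ?_, hle⟩
    exact h2 (h.redCount_eq_two h3 hr3 hd)
  · refine Or.inl fun x hx y hy hxy => ?_
    rw [hc]
    by_contra! hle
    exact hn x y ⟨hxy, hx, hy, hblack x hx, hblack y hy, fun b₃ _ _ hr3 => hr ⟨b₃, hr3⟩, hle⟩

/-- If no pair is favored, then a bidder `c` of the highest value is not black. Otherwise she and the
two red bidders of the column `insert c S` would contradict `not_dominates_three`. -/
theorem not_black_of_no_pair (hnonneg : ∀ i S, 0 ≤ v i S) (hmono : ∀ i, Monotone (v i))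
    (hsub : ∀ i, Submodular (v i)) (h : Invariant v F F noPending t) {S : Finset (Fin n)}
    (hS : S ∉ F) (hup : ∀ X, S ⊆ X → X ∉ F) (h2 : redCount t S ≠ 2)
    (hn : ∀ b₁ b₂, ¬ FavoredPair v t S b₁ b₂) {c : Fin n} (hc : v c S = OPT v S) :
    t c S ≠ .black := by
  intro hbl
  rcases h.black_origin c S hS hbl with ⟨a₁, a₂, h12, h1, h2'⟩ | ⟨hcS, hcT⟩
  · exact h2 (h.redCount_eq_two h12 h1 h2')
  have hTF : insert c S ∉ F := hup _ (Finset.subset_insert _ _)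
  have hcmem := Finset.mem_insert_self c S
  rcases h.black_origin c _ hTF hcT with ⟨a, b, hab, ha, hb⟩ | ⟨h1, -⟩
  swap
  · exact h1 hcmem
  obtain ⟨haT, ha'⟩ := h.red_origin a _ hTF ha
  obtain ⟨hbT, hb'⟩ := h.red_origin b _ hTF hb
  have hac : a ≠ c := by rintro rfl; simp [ha] at hcT
  have hbc : b ≠ c := by rintro rfl; simp [hb] at hcT
  refine not_dominates_three hnonneg hmono hsub haT hbT hcmem hab hac hbc
    (h.dominates a _ (Finset.notMem_erase _ _) ha')
    (h.dominates b _ (Finset.notMem_erase _ _) hb') ?_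
  rw [Finset.erase_insert hcS]
  exact h.dominates_of_no_pair hS h2 hn hc

/-- An iteration of the main loop raises no error and keeps the invariant. -/
theorem iteration (hnonneg : ∀ i S, 0 ≤ v i S) (hmono : ∀ i, Monotone (v i))
    (hsub : ∀ i, Submodular (v i)) (h : Invariant v F F noPending t) {S : Finset (Fin n)}
    (hdown : ∀ X, X ⊂ S → X ∈ F) (hup : ∀ X, S ⊆ X → X ∉ F) {r : Option (Table n)}
    (hr : Iteration v S t r) :
    ∃ t', r = some t' ∧ Invariant v (insert S F) (insert S F) noPending t' := by
  have hS : S ∉ F := hup S subset_rfl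
  have hmem : S ∈ insert S F := Set.mem_insert _ _
  have h0 := h.start S
  cases hr with
  | skip h2 =>
    refine ⟨t, rfl, ?_⟩
    obtain ⟨a, b, hab, he⟩ := Finset.card_eq_two.1 h2
    have ha : t a S = .red := by
      have : a ∈ ({a, b} : Finset (Fin n)) := by simp
      rw [← he] at this
      simpa using this
    have hb : t b S = .red := by
      have : b ∈ ({a, b} : Finset (Fin n)) := by simp
      rw [← he] at this
      simpa using this
    obtain ⟨haS, ha'⟩ := h.red_origin a S hS ha
    obtain ⟨-, hb'⟩ := h.red_origin b S hS hb
    refine h0.finish (h.not_white_of_pair hab ha hb) (Table.covers_of_pair hnonneg hab ha hb ?_)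
    exact OPT_le_add hnonneg hmono hsub haS hab
      (h.dominates a _ (Finset.notMem_erase _ _) ha').1
      (h.dominates b _ (Finset.notMem_erase _ _) hb').1
  | priority_one b₁ b₂ h2 hf =>
    obtain ⟨h12, h1S, h2S, hb1, hb2, hother, hopt⟩ := hf
    obtain ⟨t₁, e1, i1, r1, k1, n1⟩ := h0.colorRed_eq hnonneg hmem hb1 (fun hh => absurd h1S hh)
      (fun hh => absurd h1S hh)
    have hb2' : t₁ b₂ S ≠ .black := by
      intro hbl
      -- The closing of the column needs a red cell other than those of `b₁` and `b₂`.
      obtain ⟨d, hd1, hd2, hdr⟩ := n1 h1S b₂ hb2 hbl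
      exact hother d hd1 hd2 hdr
    obtain ⟨t₂, e2, i2, r2, k2, -⟩ := i1.colorRed_eq hnonneg hmem hb2' (fun hh => absurd h2S hh)
      (fun hh => absurd h2S hh)
    refine ⟨t₂, by rw [e1, Option.bind_some, e2], ?_⟩
    have r1' : t₂ b₁ S = .red := by rw [k2 b₁ S (by simp [r1]), r1]
    exact i2.finish (i2.not_white_of_pair h12 r1' r2)
      (Table.covers_of_pair hnonneg h12 r1' r2 hopt)
  | priority_two b h2 hn hf =>
    obtain ⟨hb, hopt⟩ := hf
    obtain ⟨t₁, e1, i1, r1, -, -⟩ := h0.colorRed_eq hnonneg hmem hb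
      (fun _ => h.dominates_of_no_pair hS h2 hn hopt)
      (fun hbS hh => hh.elim
        (fun e => hbS (e ▸ Finset.mem_insert_self b S))
        (hup _ (Finset.subset_insert _ _)))
    have hpre : ∀ a ∈ S, t₁ a S = .white → t₁ a (S.erase a) = .black := by
      intro a haS haw
      have hF : S.erase a ∈ F := hdown _ (Finset.erase_ssubset haS)
      have hnw := i1.no_white a _ hF
      have hnr : t₁ a (S.erase a) ≠ .red := fun har => by
        have := (i1.red_insert a _ (Finset.notMem_erase _ _) har).resolve_right id
        rw [Finset.insert_erase haS, haw] at this
        simp at this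
      cases hc : t₁ a (S.erase a) <;> simp_all
    rw [e1, Option.bind_some, blackenWhites,
      foldlM_blackenWhite_eq S _ t₁ (fun a _ => hpre a)]
    refine ⟨_, rfl, ?_⟩
    simp only [List.mem_finRange, true_and]
    set t₂ : Table n := fun a X => if X = S ∧ t₁ a X = .white then .black else t₁ a X with ht₂
    have hred : ∀ a X, t₂ a X = .red ↔ t₁ a X = .red := by
      intro a X
      simp only [ht₂]
      split_ifs with hh
      · simp [hh.2]
      · rfl
    have hblack : ∀ a X, t₁ a X = .black → t₂ a X = .black := by
      intro a X hh
      simp [ht₂, hh]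
    have hblackof : ∀ a X, t₂ a X = .black → t₁ a X = .black ∨ (X = S ∧ t₁ a X = .white) := by
      intro a X
      simp only [ht₂]
      split_ifs with hh
      · exact fun _ => Or.inr hh
      · exact Or.inl
    have hne : ∀ X, X ∉ insert S F → X ≠ S := fun X hX e => hX (Or.inl e)
    refine Invariant.finish ⟨?_, ?_, ?_, ?_, ?_, ?_, ?_, ?_⟩ ?_ ?_
    · intro a X haX hh
      rw [hred] at hh ⊢
      exact i1.red_insert a X haX hh
    · intro a X haX hh
      rcases hblackof a X hh with hh | ⟨rfl, hw⟩
      · exact hblack _ _ (i1.black_erase a X haX hh)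
      · exact hblack _ _ (hpre a haX hw)
    · intro X a b c hab hca hcb ha hb
      rw [hred] at ha hb
      exact hblack _ _ (i1.closed X a b c hab hca hcb ha hb)
    · intro a X haX hh
      exact i1.dominates a X haX ((hred _ _).1 hh)
    · intro a X hX hh
      rw [hred] at hh ⊢
      exact i1.red_origin a X hX hh
    · intro a X hX hh
      rcases hblackof a X hh with hh | ⟨e, -⟩
      · simp only [hred]
        exact (i1.black_origin a X hX hh).imp_right (And.imp_right (hblack _ _))
      · exact absurd e (hne X hX)
    · intro a X hX
      have := i1.no_white a X hX
      simp only [ht₂]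
      split_ifs <;> simp_all
    · intro X hX
      exact (i1.covers X hX).mono hnonneg fun a ha => (hred a X).2 ha
    · intro a
      simp only [ht₂]
      split_ifs <;> simp_all
    · exact Table.covers_of_red hnonneg ((hred b S).2 r1) hopt
  | idle h2 hn hn' =>
    have hempty : IsEmpty (Fin n) := by
      by_contra hne
      have : Nonempty (Fin n) := not_isEmpty_iff.1 hne
      obtain ⟨c, hc⟩ := exists_eq_ciSup_of_finite (f := fun i => v i S)
      exact hn' c ⟨h.not_black_of_no_pair hnonneg hmono hsub hS hup h2 hn hc, hc⟩
    refine ⟨t, rfl, h0.finish (fun b => hempty.elim b) ?_⟩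
    simp [Table.Covers, OPT]

end Invariant

/-! ### The main loop -/

theorem invariant_init (v : Fin n → Finset (Fin n) → ℝ) :
    Invariant v ∅ ∅ noPending (Table.init n) := by
  constructor <;> simp [Table.init]

theorem exists_run (v : Fin n → Finset (Fin n) → ℝ) (L : List (Finset (Fin n))) :
    ∀ t : Table n, ∃ r, Run v L t r := by
  induction L with
  | nil => exact fun t => ⟨_, Run.nil t⟩
  | cons S L ih =>
    intro t
    have hit : ∃ r, Iteration v S t r := by
      by_cases h2 : redCount t S = 2
      · exact ⟨_, Iteration.skip h2⟩
      by_cases hp : ∃ b₁ b₂, FavoredPair v t S b₁ b₂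
      · obtain ⟨b₁, b₂, hp⟩ := hp
        exact ⟨_, Iteration.priority_one b₁ b₂ h2 hp⟩
      push Not at hp
      by_cases hb : ∃ b, FavoredBidder v t S b
      · obtain ⟨b, hb⟩ := hb
        exact ⟨_, Iteration.priority_two b h2 hp hb⟩
      push Not at hb
      exact ⟨_, Iteration.idle h2 hp hb⟩
    obtain ⟨_ | t', hr⟩ := hit
    · exact ⟨_, Run.error S L t hr⟩
    · obtain ⟨r, hr'⟩ := ih t'
      exact ⟨r, Run.step S L t t' r hr hr'⟩

/-- The invariant along the main loop; the columns that are finished are those outside the list `L`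
of remaining columns. -/
theorem run_invariant {v : Fin n → Finset (Fin n) → ℝ} (hnonneg : ∀ i S, 0 ≤ v i S)
    (hmono : ∀ i, Monotone (v i)) (hsub : ∀ i, Submodular (v i)) (L : List (Finset (Fin n))) :
    ∀ t : Table n, Invariant v {X | X ∉ L} {X | X ∉ L} noPending t → L.Nodup →
      L.Pairwise (fun X Y => ¬ Y ⊂ X) → (∀ X Y, X ⊆ Y → X ∈ L → Y ∈ L) →
      ∀ r, Run v L t r →
        ∃ t', r = some t' ∧ Invariant v Set.univ Set.univ noPending t' := by
  induction L with
  | nil =>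
    intro t h _ _ _ r hr
    cases hr
    exact ⟨t, rfl, by simpa using h⟩
  | cons S L ih =>
    intro t h hnd hpw hup r hr
    rw [List.nodup_cons] at hnd
    rw [List.pairwise_cons] at hpw
    have hdown : ∀ X, X ⊂ S → X ∈ {X | X ∉ S :: L} := by
      intro X hX hmem
      rcases List.mem_cons.1 hmem with rfl | hmem
      · exact (ssubset_irrefl X) hX
      · exact hpw.1 X hmem hX
    have hup' : ∀ X, S ⊆ X → X ∉ {X | X ∉ S :: L} := fun X hX hn =>
      hn (hup S X hX List.mem_cons_self)
    have hset : insert S {X | X ∉ S :: L} = {X | X ∉ L} := by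
      ext X
      simp only [Set.mem_insert_iff, Set.mem_ofPred_eq, List.mem_cons]
      by_cases e : X = S
      · subst e; simp [hnd.1]
      · simp [e]
    cases hr with
    | error _ _ _ hit =>
      obtain ⟨t', ht', -⟩ := h.iteration hnonneg hmono hsub hdown hup' hit
      cases ht'
    | step _ _ _ t₁ _ hit hrun =>
      obtain ⟨t', ht', hinv⟩ := h.iteration hnonneg hmono hsub hdown hup' hit
      obtain rfl : t₁ = t' := by simpa using ht'
      rw [hset] at hinv
      refine ih t₁ hinv hnd.2 hpw.2 (fun X Y hXY hX => ?_) r hrun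
      rcases List.mem_cons.1 (hup X Y hXY (List.mem_cons_of_mem _ hX)) with rfl | hY
      · by_cases e : X = Y
        · rwa [← e]
        · exact absurd (hXY.ssubset_of_ne e) (hpw.1 X hX)
      · exact hY

theorem exists_inclusionCompatible (n : ℕ) :
    ∃ L : List (Finset (Fin n)), IsInclusionCompatible L := by
  have hp := List.perm_insertionSort (fun X Y : Finset (Fin n) => X.card ≤ Y.card)
    Finset.univ.toList
  refine ⟨(Finset.univ.toList).insertionSort (fun X Y : Finset (Fin n) => X.card ≤ Y.card),
    hp.nodup_iff.2 (Finset.nodup_toList _), fun S => hp.mem_iff.2 (by simp), ?_⟩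
  intro k l hkl
  have : Std.Total (fun X Y : Finset (Fin n) => X.card ≤ Y.card) := ⟨fun X Y => le_total _ _⟩
  have : IsTrans (Finset (Fin n)) (fun X Y => X.card ≤ Y.card) := ⟨fun X Y Z => le_trans⟩
  have hs := List.pairwise_insertionSort (fun X Y : Finset (Fin n) => X.card ≤ Y.card)
    Finset.univ.toList
  by_contra! hlk
  have hcard := Finset.card_lt_card hkl
  rcases hlk.lt_or_eq with hlt | rfl
  · exact absurd (List.pairwise_iff_get.1 hs l k hlt) (not_le.2 hcard)
  · exact lt_irrefl _ hcard

theorem IsInclusionCompatible.pairwise {L : List (Finset (Fin n))} (h : IsInclusionCompatible L) :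
    L.Pairwise (fun X Y => ¬ Y ⊂ X) :=
  List.pairwise_iff_get.2 fun i j hij hji => lt_asymm hij (h.2.2 j i hji)

/-! ### Payments -/

/-- The mechanism of a feasible table: a bidder with signal `1` pays the value that she would have
with signal `0`, for the additional probability that signal `1` gives her; a bidder with signal `0`
pays nothing. -/
noncomputable def Table.mechanism (t : Table n) (v : Fin n → Finset (Fin n) → ℝ)
    (hnonneg : ∀ i S, 0 ≤ v i S) (hfeas : ∀ S, ∑ i, t.alloc i S ≤ 1)
    (hle : ∀ i S, t.alloc i (S.erase i) ≤ t.alloc i S) : Mechanism n where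
  alloc := t.alloc
  payment i S := (t.alloc i S - t.alloc i (S.erase i)) * v i (S.erase i)
  alloc_nonneg i S := by
    simp only [Table.alloc]
    split_ifs <;> norm_num
  feasible := hfeas
  payment_nonneg i S := mul_nonneg (sub_nonneg.2 (hle i S)) (hnonneg i _)

theorem Table.mechanism_isExPostICIR (t : Table n) (v : Fin n → Finset (Fin n) → ℝ)
    (hnonneg : ∀ i S, 0 ≤ v i S) (hmono : ∀ i, Monotone (v i))
    (hfeas : ∀ S, ∑ i, t.alloc i S ≤ 1) (hle : ∀ i S, t.alloc i (S.erase i) ≤ t.alloc i S) :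
    (t.mechanism v hnonneg hfeas hle).IsExPostICIR v := by
  intro i S
  have hv := hmono i (Finset.erase_subset i S)
  have hl := hle i S
  have h0 : 0 ≤ t.alloc i (S.erase i) := (t.mechanism v hnonneg hfeas hle).alloc_nonneg i _
  have hn := hnonneg i (S.erase i)
  have key := mul_le_mul_of_nonneg_left hv (sub_nonneg.2 hl)
  have key0 := mul_nonneg h0 (hnonneg i S)
  by_cases hi : i ∈ S
  · simp only [hi, decide_true, Mechanism.utility, Table.mechanism, withReport, if_true,
      Finset.insert_eq_of_mem, Bool.forall_bool, Bool.false_eq_true, if_false,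
      Finset.erase_idem, le_refl, and_true]
    constructor <;> linarith
  · have e : S.erase i = S := Finset.erase_eq_of_notMem hi
    simp only [hi, decide_false, Mechanism.utility, Table.mechanism, withReport, if_true,
      Finset.erase_insert hi, Bool.forall_bool, Bool.false_eq_true, if_false,
      e, le_refl, true_and]
    rw [e] at key0
    constructor <;> linarith

/-- The table at the end of the main loop gives a mechanism with the required properties. -/
theorem Invariant.exists_mechanism {v : Fin n → Finset (Fin n) → ℝ} (hnonneg : ∀ i S, 0 ≤ v i S)
    (hmono : ∀ i, Monotone (v i)) {t : Table n}
    (h : Invariant v Set.univ Set.univ noPending t) :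
    ∃ M : Mechanism n, M.alloc = t.alloc ∧ M.IsExPostICIR v ∧ M.IsApprox v 2 := by
  have hfeas : ∀ S, ∑ i, t.alloc i S ≤ 1 := by
    intro S
    have hcount : redCount t S ≤ 2 := by
      by_contra! hlt
      obtain ⟨a, b, ha, hb, hab⟩ := Finset.one_lt_card_iff.1 ((by omega : 1 < 2).trans hlt)
      rw [h.redCount_eq_two hab (by simpa using ha) (by simpa using hb)] at hlt
      omega
    have e : ∑ i, t.alloc i S = redCount t S * (1 / 2) := by
      simp only [Table.alloc]
      rw [← Finset.sum_filter, Finset.sum_const, redCount, nsmul_eq_mul]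
    rw [e]
    have : (redCount t S : ℝ) ≤ 2 := by exact_mod_cast hcount
    linarith
  have hle : ∀ i S, t.alloc i (S.erase i) ≤ t.alloc i S := by
    intro i S
    by_cases hi : i ∈ S
    · simp only [Table.alloc]
      by_cases hr : t i (S.erase i) = .red
      · have := (h.red_insert i _ (Finset.notMem_erase _ _) hr).resolve_right id
        rw [Finset.insert_erase hi] at this
        simp [hr, this]
      · rw [if_neg hr]
        split_ifs <;> norm_num
    · rw [Finset.erase_eq_of_notMem hi]
  refine ⟨t.mechanism v hnonneg hfeas hle, rfl,
    t.mechanism_isExPostICIR v hnonneg hmono hfeas hle, fun S => ?_⟩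
  have e : (t.mechanism v hnonneg hfeas hle).welfare v S =
      1 / 2 * ∑ b, if t b S = .red then v b S else 0 := by
    simp only [Mechanism.welfare, Table.mechanism, Table.alloc, Finset.mul_sum]
    refine Finset.sum_congr rfl fun b _ => ?_
    split_ifs <;> simp
  rw [e]
  exact mul_le_mul_of_nonneg_left (h.covers S trivial) (by norm_num)

theorem run_spec {v : Fin n → Finset (Fin n) → ℝ} (hnonneg : ∀ i S, 0 ≤ v i S)
    (hmono : ∀ i, Monotone (v i)) (hsub : ∀ i, Submodular (v i)) {L : List (Finset (Fin n))}
    (hL : IsInclusionCompatible L) {r : Option (Table n)} (hr : Run v L (Table.init n) r) :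
    ∃ t : Table n, r = some t ∧ (∀ b S, t b S ≠ .white) ∧
      ∃ M : Mechanism n, M.alloc = t.alloc ∧ M.IsExPostICIR v ∧ M.IsApprox v 2 := by
  have hset : {X | X ∉ L} = ∅ := by
    ext X; simp [hL.2.1 X]
  obtain ⟨t, rfl, hinv⟩ := run_invariant hnonneg hmono hsub L (Table.init n)
    (by rw [hset]; exact invariant_init v) hL.1 hL.pairwise (fun _ Y _ _ => hL.2.1 Y) r hr
  exact ⟨t, rfl, fun b S => hinv.no_white b S trivial, hinv.exists_mechanism hnonneg hmono⟩

end SOSAuction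

theorem theorem1 (n : ℕ) (v : Fin n → Finset (Fin n) → ℝ)
    (hnonneg : ∀ i S, 0 ≤ v i S)
    (hmono : ∀ i, Monotone (v i))
    (hsub : ∀ i, SOSAuction.Submodular (v i)) :
    (∃ M : SOSAuction.Mechanism n,
      M.IsExPostICIR v ∧ M.IsApprox v 2 ∧
      ∀ i S, M.alloc i S = 0 ∨ M.alloc i S = 1 / 2) ∧
    ∀ L : List (Finset (Fin n)), SOSAuction.IsInclusionCompatible L →
      (∃ r, SOSAuction.Run v L (SOSAuction.Table.init n) r) ∧
      ∀ r, SOSAuction.Run v L (SOSAuction.Table.init n) r →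
        ∃ t : SOSAuction.Table n, r = some t ∧
          (∀ b S, t b S ≠ SOSAuction.Color.white) ∧
          ∃ M : SOSAuction.Mechanism n,
            M.alloc = t.alloc ∧ M.IsExPostICIR v ∧ M.IsApprox v 2 := by
  have key := fun (L : List (Finset (Fin n))) (hL : SOSAuction.IsInclusionCompatible L) r
    (hr : SOSAuction.Run v L (SOSAuction.Table.init n) r) =>
      SOSAuction.run_spec hnonneg hmono hsub hL hr
  refine ⟨?_, fun L hL => ⟨SOSAuction.exists_run v L _, key L hL⟩⟩
  obtain ⟨L, hL⟩ := SOSAuction.exists_inclusionCompatible n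
  obtain ⟨r, hr⟩ := SOSAuction.exists_run v L (SOSAuction.Table.init n)
  obtain ⟨t, -, -, M, hM, h1, h2⟩ := key L hL r hr
  refine ⟨M, h1, h2, fun i S => ?_⟩
  rw [hM]
  simp only [SOSAuction.Table.alloc]
  split_ifs
  exacts [Or.inr rfl, Or.inl rfl]
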